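/- Let $n\ge 0$. Let $\mathrm{Toep}_n\subseteq M_n(\mathbb C)$ be the operator system of Toeplitz matrices $T=(t_{k-l})_{k,l=0}^{n-1}$, where $M_m(\mathrm{Toep}_n)_+=M_m(\mathrm{Toep}_n)\cap M_{mn}(\mathbb C)_+$ and the unit is the identity matrix $1$. Let $C^*(\mathbb Z)_{(-n,n)}$ be the Fejér–Riesz operator system of sequences $a=(a_k)_{k\in\mathbb Z}$ supported in $(-n,n)$, with involution $(a^*)_k=\overline{a_{-k}}$ and unit $\delta_0$ (for $n=0$ the space is zero), viewed inside $C^*(\mathbb Z)\cong C(S^1)$: a matrix $(a_{ij})\in M_m(C^*(\mathbb Z)_{(-n,n)})$ is positive if $\big(\sum_k (a_{ij})_k\zeta^k\big)_{i,j}$ is positive semidefinite for every $\zeta\in S^1$. For a finite-dimensional operator system $E$, the dual vector space $E^d$ carries the involution $\varphi^*(x)=\overline{\varphi(x^*)}$ and the matrix order $$M_m(E^d)_+=\Big\{(\varphi_{ij})\in M_m(E^d) : \sum_{i,j}\varphi_{ij}(x_{ij})\ge 0\ \text{ for all } (x_{ij})\in M_m(E)_+\Big\}.$$ For a Toeplitz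 matrix $T=(t_{k-l})_{k,l}$ let $$\varphi_T(a)=\sum_{k} a_k\,t_{-k},\qquad a=(a_k)\in C^*(\mathbb Z)_{(-n,n)}.$$ Then: 1. The dual $(C^*(\mathbb Z)_{(-n,n)})^d$, with the matrix order above and the unit $\varphi_1$ (the functional of the identity matrix), is an operator system: for every $m$, $\operatorname{diag}(\varphi_1,\dots,\varphi_1)$ is an Archimedean order unit of $M_m\big((C^*(\mathbb Z)_{(-n,n)})^d\big)$. 2. The map $T\mapsto\varphi_T$ is a complete order isomorphism from $\mathrm{Toep}_n$ onto $(C^*(\mathbb Z)_{(-n,n)})^d$, that is, a linear bijection such that it and its inverse are completely positive; it maps the order unit $1$ to the order unit $\varphi_1$. 3. If $n\ge 1$, then $\varphi_1$ is a faithful state on $C^*(\mathbb Z)_{(-n,n)}$: it is positive, $\varphi_1(\delta_0)=1$, and $\varphi_1(a)>0$ for every nonzero $a\ge 0$. -/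

import Mathlib

open scoped ComplexOrder Matrix

universe u v

/-! ### Matrix-ordered `*`-vector spaces and operator systems -/

/-- For `A ∈ M_{m,n}(ℂ)` and `x ∈ M_n(E)`, the matrix `A x A^* ∈ M_m(E)`. -/
def scalarConj {E : Type u} [AddCommGroup E] [Module ℂ E] {m n : ℕ}
    (A : Matrix (Fin m) (Fin n) ℂ) (x : Matrix (Fin n) (Fin n) E) :
    Matrix (Fin m) (Fin m) E :=
  Matrix.of fun i j => ∑ k, ∑ l, (A i k * star (A j l)) • x k l

/-- A matrix order on a complex `*`-vector space `E`: for every `n` a proper convex cone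
`cone n = M_n(E)_+` of hermitian matrices over `E`, compatible with conjugation by
rectangular scalar matrices. Here `xᴴ` is the matrix with entries `(x j i)^*`. -/
structure MatrixOrdered (E : Type u) [AddCommGroup E] [Module ℂ E] [StarAddMonoid E]
    [StarModule ℂ E] where
  cone : ∀ n : ℕ, Set (Matrix (Fin n) (Fin n) E)
  zero_mem : ∀ n, (0 : Matrix (Fin n) (Fin n) E) ∈ cone n
  add_mem : ∀ {n} {x y : Matrix (Fin n) (Fin n) E}, x ∈ cone n → y ∈ cone n → x + y ∈ cone n
  smul_mem : ∀ {n} {x : Matrix (Fin n) (Fin n) E} {r : ℝ}, 0 ≤ r → x ∈ cone n →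
    (r : ℂ) • x ∈ cone n
  hermitian : ∀ {n} {x : Matrix (Fin n) (Fin n) E}, x ∈ cone n → xᴴ = x
  proper : ∀ {n} {x : Matrix (Fin n) (Fin n) E}, x ∈ cone n → -x ∈ cone n → x = 0
  conj_mem : ∀ {m n} (A : Matrix (Fin m) (Fin n) ℂ) {x : Matrix (Fin n) (Fin n) E},
    x ∈ cone n → scalarConj A x ∈ cone m

/-- An (abstract) operator system: a matrix-ordered `*`-vector space with a hermitian element
`unit` such that for every `n` the diagonal matrix `I_n = diag(unit, …, unit)` is an
Archimedean order unit of `M_n(E)`. -/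
structure OperatorSystem (E : Type u) [AddCommGroup E] [Module ℂ E] [StarAddMonoid E]
    [StarModule ℂ E] extends MatrixOrdered E where
  unit : E
  star_unit : star unit = unit
  order_unit : ∀ {n} {x : Matrix (Fin n) (Fin n) E}, xᴴ = x → ∃ t : ℝ, 0 < t ∧
    (t : ℂ) • Matrix.diagonal (fun _ => unit) - x ∈ cone n ∧
    (t : ℂ) • Matrix.diagonal (fun _ => unit) + x ∈ cone n
  archimedean : ∀ {n} {x : Matrix (Fin n) (Fin n) E},
    (∀ t : ℝ, 0 < t → (t : ℂ) • Matrix.diagonal (fun _ => unit) + x ∈ cone n) → x ∈ cone n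

section Maps

variable {E : Type u} [AddCommGroup E] [Module ℂ E] [StarAddMonoid E] [StarModule ℂ E]
  {F : Type v} [AddCommGroup F] [Module ℂ F] [StarAddMonoid F] [StarModule ℂ F]

/-- A linear map is completely positive if all its entrywise amplifications
`M_n(E) → M_n(F)` map the positive cone to the positive cone. -/
def IsCompletelyPositive (M : MatrixOrdered E) (N : MatrixOrdered F) (f : E →ₗ[ℂ] F) : Prop :=
  ∀ (n : ℕ) (x : Matrix (Fin n) (Fin n) E), x ∈ M.cone n → x.map f ∈ N.cone n

/-- A complete order isomorphism: a linear bijection such that it and its inverse are both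
completely positive. -/
def IsCompleteOrderIso (M : MatrixOrdered E) (N : MatrixOrdered F) (f : E ≃ₗ[ℂ] F) : Prop :=
  IsCompletelyPositive M N f.toLinearMap ∧ IsCompletelyPositive N M f.symm.toLinearMap

/-- The positive cone `E_+ = M_1(E)_+` of an operator system. -/
def OperatorSystem.positive (S : OperatorSystem E) : Set E :=
  {x | (Matrix.of fun _ _ => x : Matrix (Fin 1) (Fin 1) E) ∈ S.cone 1}

/-- A faithful state: a positive unital linear functional `χ` with `χ x > 0` for all
nonzero positive `x`. -/
structure OperatorSystem.IsFaithfulState (S : OperatorSystem E) (χ : E →ₗ[ℂ] ℂ) : Prop where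
  nonneg : ∀ x ∈ S.positive, 0 ≤ χ x
  map_unit : χ S.unit = 1
  faithful : ∀ x ∈ S.positive, x ≠ 0 → 0 < χ x

end Maps

/-! ### The dual of an operator system -/

/-- The dual vector space `E^d` of all linear functionals on `E` (the operator systems below
are finite-dimensional). -/
def DualSpace (E : Type u) [AddCommGroup E] [Module ℂ E] : Type u := E →ₗ[ℂ] ℂ

namespace DualSpace

variable {E : Type u} [AddCommGroup E] [Module ℂ E]

instance : AddCommGroup (DualSpace E) := inferInstanceAs (AddCommGroup (E →ₗ[ℂ] ℂ))

instance : Module ℂ (DualSpace E) := inferInstanceAs (Module ℂ (E →ₗ[ℂ] ℂ))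

instance : FunLike (DualSpace E) E ℂ := inferInstanceAs (FunLike (E →ₗ[ℂ] ℂ) E ℂ)

instance : LinearMapClass (DualSpace E) ℂ E ℂ :=
  inferInstanceAs (LinearMapClass (E →ₗ[ℂ] ℂ) ℂ E ℂ)

/-- An element of the dual space, seen as a linear map. -/
def toLinear (φ : DualSpace E) : E →ₗ[ℂ] ℂ := φ

@[ext] theorem ext {φ ψ : DualSpace E} (h : ∀ x, φ x = ψ x) : φ = ψ := LinearMap.ext h

@[simp] theorem add_apply (φ ψ : DualSpace E) (x : E) : (φ + ψ) x = φ x + ψ x := rfl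

@[simp] theorem zero_apply (x : E) : (0 : DualSpace E) x = 0 := rfl

@[simp] theorem neg_apply (φ : DualSpace E) (x : E) : (-φ) x = -φ x := rfl

@[simp] theorem smul_apply (c : ℂ) (φ : DualSpace E) (x : E) : (c • φ) x = c * φ x := rfl

@[simp] theorem sum_apply {ι : Type*} (s : Finset ι) (φ : ι → DualSpace E) (x : E) :
    (∑ i ∈ s, φ i) x = ∑ i ∈ s, φ i x := LinearMap.sum_apply s φ x

variable [StarAddMonoid E] [StarModule ℂ E]

/-- The involution of the dual: `φ^*(x)` is the complex conjugate of `φ(x^*)`. -/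
instance : Star (DualSpace E) where
  star φ :=
    ({ toFun := fun x => star (φ (star x))
       map_add' := fun x y => by simp
       map_smul' := fun c x => by simp } : E →ₗ[ℂ] ℂ)

@[simp] theorem star_apply (φ : DualSpace E) (x : E) : (star φ) x = star (φ (star x)) := rfl

instance : StarAddMonoid (DualSpace E) where
  star_involutive φ := by ext x; simp
  star_add φ ψ := by ext x; simp

instance : StarModule ℂ (DualSpace E) where
  star_smul c φ := by ext x; simp

end DualSpace

section Dual

variable {E : Type u} [AddCommGroup E] [Module ℂ E]

/-- The componentwise pairing `φ(x) = ∑_{i,j} φ_{ij}(x_{ij})` of `M_n(E^d)` with `M_n(E)`. -/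
def matrixPairing {n : ℕ} (φ : Matrix (Fin n) (Fin n) (DualSpace E))
    (x : Matrix (Fin n) (Fin n) E) : ℂ :=
  ∑ i, ∑ j, φ i j (x i j)

theorem matrixPairing_add {n : ℕ} (φ : Matrix (Fin n) (Fin n) (DualSpace E))
    (x y : Matrix (Fin n) (Fin n) E) :
    matrixPairing φ (x + y) = matrixPairing φ x + matrixPairing φ y := by
  simp [matrixPairing, Finset.sum_add_distrib]

theorem matrixPairing_smul {n : ℕ} (φ : Matrix (Fin n) (Fin n) (DualSpace E)) (c : ℂ)
    (x : Matrix (Fin n) (Fin n) E) :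
    matrixPairing φ (c • x) = c * matrixPairing φ x := by
  simp [matrixPairing, Finset.mul_sum]

theorem matrixPairing_single {n : ℕ} (φ : Matrix (Fin n) (Fin n) (DualSpace E)) (i j : Fin n)
    (x : E) : matrixPairing φ (Matrix.single i j x) = φ i j x := by
  unfold matrixPairing
  rw [Finset.sum_eq_single i, Finset.sum_eq_single j]
  · simp
  · intro l _ hl
    simp [Matrix.single, Ne.symm hl]
  · simp
  · intro k _ hk
    apply Finset.sum_eq_zero
    intro l _
    simp [Matrix.single, Ne.symm hk]
  · simp

theorem matrixPairing_scalarConj {m n : ℕ} (A : Matrix (Fin m) (Fin n) ℂ)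
    (φ : Matrix (Fin n) (Fin n) (DualSpace E)) (x : Matrix (Fin m) (Fin m) E) :
    matrixPairing (scalarConj A φ) x = matrixPairing φ (scalarConj Aᵀ x) := by
  simp only [matrixPairing, scalarConj, Matrix.of_apply, DualSpace.sum_apply,
    DualSpace.smul_apply, map_sum, map_smul, smul_eq_mul, Matrix.transpose_apply]
  have h : ∀ (f : Fin m → Fin m → Fin n → Fin n → ℂ),
      ∑ i, ∑ j, ∑ k, ∑ l, f i j k l = ∑ k, ∑ l, ∑ i, ∑ j, f i j k l := by
    intro f
    calc ∑ i, ∑ j, ∑ k, ∑ l, f i j k l = ∑ i, ∑ k, ∑ j, ∑ l, f i j k l := by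
          exact Finset.sum_congr rfl fun i _ => Finset.sum_comm
      _ = ∑ k, ∑ i, ∑ j, ∑ l, f i j k l := Finset.sum_comm
      _ = ∑ k, ∑ i, ∑ l, ∑ j, f i j k l := by
          exact Finset.sum_congr rfl fun k _ => Finset.sum_congr rfl fun i _ => Finset.sum_comm
      _ = ∑ k, ∑ l, ∑ i, ∑ j, f i j k l := by
          exact Finset.sum_congr rfl fun k _ => Finset.sum_comm
  exact h _

variable [StarAddMonoid E] [StarModule ℂ E]

theorem OperatorSystem.exists_sub (S : OperatorSystem E) {n : ℕ}
    {x : Matrix (Fin n) (Fin n) E} (hx : xᴴ = x) :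
    ∃ y ∈ S.cone n, ∃ z ∈ S.cone n, x + y = z := by
  obtain ⟨t, ht, -, h⟩ := S.order_unit hx
  obtain ⟨s, hs, h1, -⟩ := S.order_unit (n := n) (x := 0) (by simp)
  rw [sub_zero] at h1
  refine ⟨_, ?_, _, h, add_comm _ _⟩
  have := S.smul_mem (r := t / s) (by positivity) h1
  rwa [smul_smul, ← Complex.ofReal_mul, div_mul_cancel₀ _ hs.ne'] at this

theorem hermitian_decomp {n : ℕ} (x : Matrix (Fin n) (Fin n) E) :
    ∃ y z : Matrix (Fin n) (Fin n) E, yᴴ = y ∧ zᴴ = z ∧ x = y + Complex.I • z ∧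
      xᴴ = y + (-Complex.I) • z := by
  have e1 : ((2 : ℂ)⁻¹ + 2⁻¹) = 1 := by norm_num
  refine ⟨(2 : ℂ)⁻¹ • (x + xᴴ), (-Complex.I * 2⁻¹) • (x - xᴴ), ?_, ?_, ?_, ?_⟩
  · ext i j
    simp [Matrix.conjTranspose_apply, star_smul, add_comm]
  · ext i j
    simp only [Matrix.conjTranspose_apply, Matrix.smul_apply, Matrix.sub_apply, star_smul,
      star_sub, star_star]
    rw [← neg_sub (x i j), smul_neg, ← neg_smul]
    congr 1
    simp
  · rw [smul_smul, ← mul_assoc, mul_neg, Complex.I_mul_I, neg_neg, one_mul, smul_add, smul_sub]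
    rw [add_add_sub_cancel, ← add_smul, e1, one_smul]
  · rw [smul_smul, ← mul_assoc, neg_mul_neg, Complex.I_mul_I, smul_add, smul_sub]
    rw [neg_mul, one_mul, neg_smul, neg_smul, sub_neg_eq_add]
    rw [show ∀ a b : Matrix (Fin n) (Fin n) E, a + b + (-a + b) = b + b by intros; abel,
      ← add_smul, e1, one_smul]

theorem matrixPairing_star_of_nonneg (S : OperatorSystem E) {n : ℕ}
    {φ : Matrix (Fin n) (Fin n) (DualSpace E)} (hφ : ∀ x ∈ S.cone n, 0 ≤ matrixPairing φ x)
    (x : Matrix (Fin n) (Fin n) E) : matrixPairing φ xᴴ = star (matrixPairing φ x) := by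
  have key : ∀ y : Matrix (Fin n) (Fin n) E, yᴴ = y →
      star (matrixPairing φ y) = matrixPairing φ y := by
    intro y hy
    obtain ⟨p, hp, q, hq, h⟩ := S.exists_sub hy
    have h' : matrixPairing φ y = matrixPairing φ q - matrixPairing φ p := by
      rw [← h, matrixPairing_add]; ring
    rw [h', star_sub, (IsSelfAdjoint.of_nonneg (hφ _ hp)).star_eq,
      (IsSelfAdjoint.of_nonneg (hφ _ hq)).star_eq]
  obtain ⟨y, z, hy, hz, h1, h2⟩ := hermitian_decomp x
  rw [h2, h1]
  rw [matrixPairing_add, matrixPairing_add, matrixPairing_smul, matrixPairing_smul, star_add,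
    star_mul, key y hy, key z hz, show star Complex.I = -Complex.I from Complex.conj_I, mul_comm]

/-- The dual matrix order of an operator system:
`M_n(E^d)_+ = {φ ∈ M_n(E^d) | φ(x) ≥ 0 for all x ∈ M_n(E)_+}`. -/
def OperatorSystem.dual (S : OperatorSystem E) : MatrixOrdered (DualSpace E) where
  cone n := {φ | ∀ x ∈ S.cone n, 0 ≤ matrixPairing φ x}
  zero_mem n x _ := by simp [matrixPairing]
  add_mem {n φ ψ} hφ hψ x hx := by
    have : matrixPairing (φ + ψ) x = matrixPairing φ x + matrixPairing ψ x := by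
      simp [matrixPairing, Finset.sum_add_distrib]
    rw [this]
    exact add_nonneg (hφ x hx) (hψ x hx)
  smul_mem {n φ r} hr hφ x hx := by
    have : matrixPairing ((r : ℂ) • φ) x = (r : ℂ) * matrixPairing φ x := by
      simp only [matrixPairing, Finset.mul_sum, Matrix.smul_apply, DualSpace.smul_apply]
    rw [this]
    exact mul_nonneg (by exact_mod_cast hr) (hφ x hx)
  hermitian {n φ} hφ := by
    ext i j x
    have h := matrixPairing_star_of_nonneg S hφ (Matrix.single i j x)
    rw [Matrix.conjTranspose_single, matrixPairing_single, matrixPairing_single] at h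
    simp only [Matrix.conjTranspose_apply, DualSpace.star_apply]
    rw [h, star_star]
  proper {n φ} hφ hφ' := by
    have hc : ∀ x ∈ S.cone n, matrixPairing φ x = 0 := by
      intro x hx
      have h2 := hφ' x hx
      have : matrixPairing (-φ) x = -matrixPairing φ x := by simp [matrixPairing]
      rw [this] at h2
      exact le_antisymm (neg_nonneg.mp h2) (hφ x hx)
    have hh : ∀ x : Matrix (Fin n) (Fin n) E, xᴴ = x → matrixPairing φ x = 0 := by
      intro x hx
      obtain ⟨p, hp, q, hq, h⟩ := S.exists_sub hx
      have := matrixPairing_add φ x p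
      rw [h, hc _ hq, hc _ hp, add_zero] at this
      exact this.symm
    ext i j x
    obtain ⟨y, z, hy, hz, h1, -⟩ := hermitian_decomp (Matrix.single i j x)
    have := matrixPairing_single φ i j x
    rw [h1, matrixPairing_add, matrixPairing_smul, hh y hy, hh z hz] at this
    simp [← this]
  conj_mem {m n} A {φ} hφ x hx := by
    rw [matrixPairing_scalarConj]
    exact hφ _ (S.conj_mem _ hx)

end Dual

/-! ### Facts on positive semidefinite matrices -/

section PosSemidef

variable {ι : Type*} [Fintype ι]

theorem posSemidef_eq_zero {H : Matrix ι ι ℂ} (h1 : H.PosSemidef) (h2 : (-H).PosSemidef) :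
    H = 0 := by
  apply h1.trace_eq_zero_iff.mp
  have := h2.trace_nonneg
  rw [Matrix.trace_neg] at this
  exact le_antisymm (neg_nonneg.mp this) h1.trace_nonneg

theorem posSemidef_of_forall_add [DecidableEq ι] {H : Matrix ι ι ℂ}
    (h : ∀ t : ℝ, 0 < t → ((t : ℂ) • (1 : Matrix ι ι ℂ) + H).PosSemidef) : H.PosSemidef := by
  refine Matrix.PosSemidef.of_dotProduct_mulVec_nonneg ?_ fun x => ?_
  · have h1 := (h 1 one_pos).1.sub (Matrix.isHermitian_one (n := ι) (α := ℂ))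
    simpa using h1
  · have hlim : Filter.Tendsto
        (fun t : ℝ => (t : ℂ) * (star x ⬝ᵥ x) + star x ⬝ᵥ H.mulVec x)
        (nhdsWithin 0 (Set.Ioi 0)) (nhds (star x ⬝ᵥ H.mulVec x)) := by
      have : Continuous fun t : ℝ => (t : ℂ) * (star x ⬝ᵥ x) + star x ⬝ᵥ H.mulVec x := by
        fun_prop
      have h0 := this.tendsto 0
      simp only [Complex.ofReal_zero, zero_mul, zero_add] at h0
      exact h0.mono_left nhdsWithin_le_nhds
    refine ge_of_tendsto hlim ?_
    filter_upwards [self_mem_nhdsWithin] with t ht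
    have := (h t ht).dotProduct_mulVec_nonneg x
    simpa [Matrix.add_mulVec, Matrix.smul_mulVec, dotProduct_add, dotProduct_smul] using this

theorem posSemidef_add_of_bound [DecidableEq ι] {H : Matrix ι ι ℂ} (hH : H.IsHermitian) {C : ℝ} (hC0 : 0 ≤ C)
    (hC : ∀ i j, ‖H i j‖ ≤ C) {t : ℝ} (ht : C * Fintype.card ι ≤ t) :
    ((t : ℂ) • (1 : Matrix ι ι ℂ) + H).PosSemidef := by
  refine Matrix.PosSemidef.of_dotProduct_mulVec_nonneg ?_ fun x => ?_
  · refine Matrix.IsHermitian.add ?_ hH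
    ext i j
    by_cases h : i = j
    · simp [h]
    · simp [h, Ne.symm h]
  · have hreal : (star x ⬝ᵥ H.mulVec x).im = 0 := hH.im_star_dotProduct_mulVec_self x
    have hb : ‖star x ⬝ᵥ H.mulVec x‖ ≤ t * ∑ i, ‖x i‖ ^ 2 := by
      have hsum : (∑ i, ‖x i‖) ^ 2 ≤ Fintype.card ι * ∑ i, ‖x i‖ ^ 2 := by
        simpa using sq_sum_le_card_mul_sum_sq (s := Finset.univ) (f := fun i => ‖x i‖)
      have h1 : ‖star x ⬝ᵥ H.mulVec x‖ ≤ C * (∑ i, ‖x i‖) ^ 2 := by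
        have e : C * (∑ i, ‖x i‖) ^ 2 = ∑ i, ∑ j, ‖x i‖ * (C * ‖x j‖) := by
          simp only [← Finset.mul_sum, ← Finset.sum_mul]
          ring
        rw [e]
        simp only [dotProduct, Matrix.mulVec, Finset.mul_sum]
        refine (norm_sum_le _ _).trans ?_
        refine Finset.sum_le_sum fun i _ => (norm_sum_le _ _).trans ?_
        refine Finset.sum_le_sum fun j _ => ?_
        rw [norm_mul, norm_mul, Pi.star_apply, norm_star]
        have := hC i j
        gcongr
      calc _ ≤ _ := h1
        _ ≤ C * (Fintype.card ι * ∑ i, ‖x i‖ ^ 2) := by gcongr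
        _ = C * Fintype.card ι * ∑ i, ‖x i‖ ^ 2 := by ring
        _ ≤ _ := by gcongr
    have hx : star x ⬝ᵥ x = ((∑ i, ‖x i‖ ^ 2 : ℝ) : ℂ) := by
      simp [dotProduct, Complex.conj_mul']
    have hexp : star x ⬝ᵥ ((t : ℂ) • (1 : Matrix ι ι ℂ) + H).mulVec x =
        ((t * ∑ i, ‖x i‖ ^ 2 : ℝ) : ℂ) + star x ⬝ᵥ H.mulVec x := by
      rw [Matrix.add_mulVec, Matrix.smul_mulVec, dotProduct_add, dotProduct_smul,
        Matrix.one_mulVec, hx]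
      push_cast
      rfl
    rw [hexp, Complex.le_def]
    have := (abs_le.mp ((Complex.abs_re_le_norm _).trans hb)).1
    constructor
    · rw [Complex.add_re, Complex.ofReal_re, Complex.zero_re]; linarith
    · rw [Complex.add_im, Complex.ofReal_im, hreal]; simp

end PosSemidef

/-! ### The Toeplitz operator system -/

/-- The space of `n × n` complex Toeplitz matrices `T = (t_{k-l})_{k,l}`. -/
def Toep (n : ℕ) : Submodule ℂ (Matrix (Fin n) (Fin n) ℂ) where
  carrier := {T | ∃ t : ℤ → ℂ, ∀ k l : Fin n, T k l = t ((k : ℤ) - (l : ℤ))}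
  zero_mem' := ⟨0, fun _ _ => rfl⟩
  add_mem' := by
    rintro _ _ ⟨s, hs⟩ ⟨t, ht⟩
    exact ⟨s + t, fun k l => by simp [hs, ht]⟩
  smul_mem' := by
    rintro c _ ⟨t, ht⟩
    exact ⟨c • t, fun k l => by simp [ht]⟩

namespace Toep

variable {n : ℕ}

/-- The involution is the conjugate transpose of matrices. -/
instance : Star (Toep n) where
  star T := ⟨(T : Matrix (Fin n) (Fin n) ℂ)ᴴ, by
    obtain ⟨t, ht⟩ := T.2
    refine ⟨fun k => star (t (-k)), fun k l => ?_⟩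
    simp [Matrix.conjTranspose_apply, ht]⟩

@[simp] theorem coe_star (T : Toep n) :
    ((star T : Toep n) : Matrix (Fin n) (Fin n) ℂ) = (T : Matrix (Fin n) (Fin n) ℂ)ᴴ := rfl

instance : StarAddMonoid (Toep n) where
  star_involutive T := Subtype.ext (by simp)
  star_add S T := Subtype.ext (by simp)

instance : StarModule ℂ (Toep n) where
  star_smul c T := Subtype.ext (by simp)

/-- The identity matrix as a Toeplitz matrix. -/
instance : One (Toep n) where
  one := ⟨1, fun k => if k = 0 then 1 else 0, fun k l => by
    simp [Matrix.one_apply, sub_eq_zero, Fin.ext_iff]⟩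

@[simp] theorem coe_one : ((1 : Toep n) : Matrix (Fin n) (Fin n) ℂ) = 1 := rfl

/-- The complex `mn × mn` block matrix of an element of `M_m(Toep_n) ⊆ M_m(M_n(ℂ))`. -/
def block {m : ℕ} (x : Matrix (Fin m) (Fin m) (Toep n)) :
    Matrix (Fin m × Fin n) (Fin m × Fin n) ℂ :=
  Matrix.of fun p q => (x p.1 q.1 : Matrix (Fin n) (Fin n) ℂ) p.2 q.2

theorem block_add {m : ℕ} (x y : Matrix (Fin m) (Fin m) (Toep n)) :
    block (x + y) = block x + block y := rfl

theorem block_neg {m : ℕ} (x : Matrix (Fin m) (Fin m) (Toep n)) :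
    block (-x) = -block x := rfl

theorem block_smul {m : ℕ} (c : ℂ) (x : Matrix (Fin m) (Fin m) (Toep n)) :
    block (c • x) = c • block x := rfl

theorem block_conjTranspose {m : ℕ} (x : Matrix (Fin m) (Fin m) (Toep n)) :
    block xᴴ = (block x)ᴴ := rfl

theorem block_injective {m : ℕ} :
    Function.Injective (block : Matrix (Fin m) (Fin m) (Toep n) → _) := by
  intro x y h
  ext i j k l
  exact congrFun (congrFun h (i, k)) (j, l)

theorem block_one {m : ℕ} :
    block (Matrix.diagonal fun _ : Fin m => (1 : Toep n)) = 1 := by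
  ext ⟨i, k⟩ ⟨j, l⟩
  by_cases h : i = j
  · simp [block, h, Matrix.one_apply]
  · simp [block, h, Matrix.one_apply]

theorem block_scalarConj {m m' : ℕ} (A : Matrix (Fin m') (Fin m) ℂ)
    (x : Matrix (Fin m) (Fin m) (Toep n)) :
    block (scalarConj A x) =
      (Matrix.of fun (p : Fin m' × Fin n) (q : Fin m × Fin n) =>
        if p.2 = q.2 then A p.1 q.1 else 0) * block x *
      (Matrix.of fun (p : Fin m' × Fin n) (q : Fin m × Fin n) =>
        if p.2 = q.2 then A p.1 q.1 else 0)ᴴ := by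
  ext ⟨i, k⟩ ⟨j, l⟩
  simp only [block, scalarConj, Matrix.of_apply, Matrix.mul_apply, Matrix.conjTranspose_apply,
    Fintype.sum_prod_type, Submodule.coe_sum, Submodule.coe_smul, Matrix.sum_apply,
    Matrix.smul_apply, smul_eq_mul, ite_mul, zero_mul, apply_ite star, star_zero, mul_ite,
    mul_zero, Finset.sum_ite_eq, Finset.mem_univ, if_true, Finset.sum_mul]
  rw [Finset.sum_comm]
  exact Finset.sum_congr rfl fun a _ => Finset.sum_congr rfl fun b _ => by ring

end Toep

/-- The Toeplitz operator system in `M_n(ℂ)`: an element of `M_m(Toep_n)` is positive if it is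
positive in `M_m(M_n(ℂ)) = M_{mn}(ℂ)`; the order unit is the identity matrix. -/
def toeplitzSystem (n : ℕ) : OperatorSystem (Toep n) where
  cone m := {x | (Toep.block x).PosSemidef}
  zero_mem m := Matrix.PosSemidef.zero
  add_mem hx hy := Matrix.PosSemidef.add hx hy
  smul_mem {m x r} hr hx := by
    rw [Set.mem_ofPred_eq, Toep.block_smul]
    exact Matrix.PosSemidef.smul hx (by exact_mod_cast hr)
  hermitian {m x} hx := Toep.block_injective hx.1
  proper {m x} hx hx' := Toep.block_injective (posSemidef_eq_zero hx hx')
  conj_mem {_ _} A {_} hx := by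
    rw [Set.mem_ofPred_eq, Toep.block_scalarConj]
    exact Matrix.PosSemidef.mul_mul_conjTranspose_same hx _
  unit := 1
  star_unit := Subtype.ext (by simp)
  order_unit {m x} hx := by
    have hH : (Toep.block x).IsHermitian := by
      rw [Matrix.IsHermitian, ← Toep.block_conjTranspose, hx]
    set C : ℝ := ∑ p, ∑ q, ‖Toep.block x p q‖ with hCdef
    have hC0 : 0 ≤ C := by positivity
    have hC : ∀ p q, ‖Toep.block x p q‖ ≤ C := fun p q =>
      (Finset.single_le_sum (f := fun q => ‖Toep.block x p q‖) (fun _ _ => norm_nonneg _)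
        (Finset.mem_univ q)).trans
      (Finset.single_le_sum (f := fun p => ∑ q, ‖Toep.block x p q‖)
        (fun _ _ => Finset.sum_nonneg fun _ _ => norm_nonneg _) (Finset.mem_univ p))
    refine ⟨C * Fintype.card (Fin m × Fin n) + 1, by positivity, ?_, ?_⟩
    · rw [Set.mem_ofPred_eq, sub_eq_add_neg, Toep.block_add, Toep.block_smul, Toep.block_one,
        Toep.block_neg]
      exact posSemidef_add_of_bound hH.neg hC0 (by simpa using hC) (by simp)
    · rw [Set.mem_ofPred_eq, Toep.block_add, Toep.block_smul, Toep.block_one]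
      exact posSemidef_add_of_bound hH hC0 hC (by simp)
  archimedean {m x} h := posSemidef_of_forall_add fun t ht => by
    have := h t ht
    rwa [Set.mem_ofPred_eq, Toep.block_add, Toep.block_smul, Toep.block_one] at this

/-! ### The Fejér–Riesz operator system -/

/-- The space `C^*(ℤ)_{(-n,n)}` of sequences `a = (a_k)_{k ∈ ℤ}` with support in `(-n,n)`. -/
def FejerRiesz (n : ℕ) : Submodule ℂ (ℤ → ℂ) where
  carrier := {a | Function.support a ⊆ Set.Ioo (-(n : ℤ)) n}
  zero_mem' := by simp
  add_mem' {a b} ha hb := (Function.support_add a b).trans (Set.union_subset ha hb)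
  smul_mem' c a ha := (Function.support_const_smul_subset c a).trans ha

namespace FejerRiesz

variable {n : ℕ}

/-- The `k`-th coefficient `a_k`. -/
instance : CoeFun (FejerRiesz n) (fun _ => ℤ → ℂ) := ⟨Subtype.val⟩

theorem apply_eq_zero (a : FejerRiesz n) {k : ℤ} (hk : k ∉ Set.Ioo (-(n : ℤ)) n) : a k = 0 := by
  by_contra h
  exact hk (a.2 h)

/-- The involution `(a^*)_k = conj (a_{-k})`. -/
instance : Star (FejerRiesz n) where
  star a := ⟨fun k => star (a (-k)), fun k hk => by
    have h : a (-k) ≠ 0 := fun h => hk (by simp [h])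
    have := a.2 h
    simp only [Set.mem_Ioo] at this ⊢
    omega⟩

@[simp] theorem star_apply (a : FejerRiesz n) (k : ℤ) :
    (star a : FejerRiesz n) k = star (a (-k)) := rfl

instance : StarAddMonoid (FejerRiesz n) where
  star_involutive a := Subtype.ext (by ext k; simp)
  star_add a b := Subtype.ext (by ext k; simp)

instance : StarModule ℂ (FejerRiesz n) where
  star_smul c a := Subtype.ext (by ext k; simp)

/-- The unit `δ_0` of the group algebra (for `n = 0` the space is zero and this is `0`). -/
instance : One (FejerRiesz n) where
  one := ⟨fun k => if k = 0 ∧ 0 < n then 1 else 0, fun k hk => by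
    by_cases h : k = 0 ∧ 0 < n
    · simp only [Set.mem_Ioo]
      omega
    · simp [h] at hk⟩

theorem one_apply (k : ℤ) : (1 : FejerRiesz n) k = if k = 0 ∧ 0 < n then 1 else 0 := rfl

/-- The value `∑_k a_k ζ^k` at a point `ζ` of the unit circle. -/
noncomputable def eval (ζ : Circle) : FejerRiesz n →ₗ[ℂ] ℂ where
  toFun a := ∑ k ∈ Finset.Ioo (-(n : ℤ)) n, a k * (ζ : ℂ) ^ k
  map_add' a b := by simp [add_mul, Finset.sum_add_distrib]
  map_smul' c a := by simp [Finset.mul_sum, mul_assoc]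

theorem eval_apply (ζ : Circle) (a : FejerRiesz n) :
    eval ζ a = ∑ k ∈ Finset.Ioo (-(n : ℤ)) n, a k * (ζ : ℂ) ^ k := rfl

theorem eval_star (ζ : Circle) (a : FejerRiesz n) : eval ζ (star a) = star (eval ζ a) := by
  rw [eval_apply, eval_apply, star_sum]
  refine Finset.sum_nbij' (fun k => -k) (fun k => -k) ?_ ?_ ?_ ?_ ?_
  · intro k hk
    simp only [Finset.mem_Ioo] at hk ⊢
    omega
  · intro k hk
    simp only [Finset.mem_Ioo] at hk ⊢
    omega
  · simp
  · simp
  · intro k _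
    rw [star_apply, star_mul', star_zpow₀]
    congr 1
    rw [zpow_neg, ← inv_zpow]
    congr 1
    exact (congrArg (fun z : ℂ => z⁻¹) (Circle.coe_inv_eq_conj ζ)).symm.trans (by simp) |>.symm

theorem eval_one (hn : 0 < n) (ζ : Circle) : eval ζ (1 : FejerRiesz n) = 1 := by
  rw [eval_apply, Finset.sum_eq_single 0]
  · simp [one_apply, hn]
  · intro k _ hk
    simp [one_apply, hk]
  · intro h
    simp at h
    omega

theorem norm_eval_le (ζ : Circle) (a : FejerRiesz n) :
    ‖eval ζ a‖ ≤ ∑ k ∈ Finset.Ioo (-(n : ℤ)) n, ‖a k‖ := by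
  rw [eval_apply]
  refine (norm_sum_le _ _).trans (Finset.sum_le_sum fun k _ => ?_)
  rw [norm_mul, norm_zpow, Circle.norm_coe, one_zpow, mul_one]

theorem infinite_circle : (Set.range ((↑) : Circle → ℂ)).Infinite := by
  have h : (Set.Icc (0 : ℝ) 1).InjOn fun x => (Circle.exp x : ℂ) := fun x hx y hy hxy =>
    Circle.exp_injOn_Icc (by linarith [Real.pi_gt_three]) hx hy (Circle.ext hxy)
  refine (((Set.Icc_infinite (zero_lt_one' ℝ)).image h)).mono ?_
  rintro _ ⟨x, -, rfl⟩
  exact ⟨_, rfl⟩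

theorem eq_zero_of_eval {a : FejerRiesz n} (h : ∀ ζ, eval ζ a = 0) : a = 0 := by
  set p : Polynomial ℂ := ∑ k ∈ Finset.Ioo (-(n : ℤ)) n,
    Polynomial.monomial (k + n).toNat (a k) with hp
  have hroot : ∀ ζ : Circle, p.eval (ζ : ℂ) = 0 := by
    intro ζ
    have h1 := h ζ
    rw [eval_apply] at h1
    have h2 : p.eval (ζ : ℂ) = (ζ : ℂ) ^ (n : ℤ) *
        ∑ k ∈ Finset.Ioo (-(n : ℤ)) n, a k * (ζ : ℂ) ^ k := by
      rw [hp, Polynomial.eval_finsetSum, Finset.mul_sum]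
      refine Finset.sum_congr rfl fun k hk => ?_
      rw [Finset.mem_Ioo] at hk
      rw [Polynomial.eval_monomial, ← zpow_natCast, Int.toNat_of_nonneg (by omega),
        zpow_add₀ (Circle.coe_ne_zero ζ)]
      ring
    rw [h2, h1, mul_zero]
  have hp0 : p = 0 := by
    refine Polynomial.eq_zero_of_infinite_isRoot p (infinite_circle.mono ?_)
    rintro _ ⟨ζ, rfl⟩
    exact hroot ζ
  refine Subtype.ext (funext fun k => ?_)
  by_cases hk : k ∈ Set.Ioo (-(n : ℤ)) n
  · have hc : p.coeff (k + n).toNat = a k := by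
      rw [hp, Polynomial.finsetSum_coeff, Finset.sum_eq_single k]
      · simp
      · intro l hl hlk
        rw [Finset.mem_Ioo] at hl
        rw [Set.mem_Ioo] at hk
        rw [Polynomial.coeff_monomial, if_neg (by omega)]
      · intro h'
        exact absurd (by simpa using hk) h'
    rw [hp0] at hc
    exact hc.symm
  · exact apply_eq_zero a hk

theorem map_eval_scalarConj {m m' : ℕ} (ζ : Circle) (A : Matrix (Fin m') (Fin m) ℂ)
    (x : Matrix (Fin m) (Fin m) (FejerRiesz n)) :
    (scalarConj A x).map (eval ζ) = A * x.map (eval ζ) * Aᴴ := by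
  ext i j
  simp only [scalarConj, Matrix.map_apply, Matrix.of_apply, map_sum, map_smul, smul_eq_mul,
    Matrix.mul_apply, Matrix.conjTranspose_apply, Finset.sum_mul]
  rw [Finset.sum_comm]
  exact Finset.sum_congr rfl fun a _ => Finset.sum_congr rfl fun b _ => by ring

theorem map_eval_add {m : ℕ} (ζ : Circle) (x y : Matrix (Fin m) (Fin m) (FejerRiesz n)) :
    (x + y).map (eval ζ) = x.map (eval ζ) + y.map (eval ζ) := by
  ext i j; simp

theorem map_eval_neg {m : ℕ} (ζ : Circle) (x : Matrix (Fin m) (Fin m) (FejerRiesz n)) :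
    (-x).map (eval ζ) = -x.map (eval ζ) := by
  ext i j; simp

theorem map_eval_smul {m : ℕ} (ζ : Circle) (c : ℂ) (x : Matrix (Fin m) (Fin m) (FejerRiesz n)) :
    (c • x).map (eval ζ) = c • x.map (eval ζ) := by
  ext i j; simp

theorem map_eval_conjTranspose {m : ℕ} (ζ : Circle)
    (x : Matrix (Fin m) (Fin m) (FejerRiesz n)) :
    xᴴ.map (eval ζ) = (x.map (eval ζ))ᴴ := by
  ext i j
  simp only [Matrix.map_apply, Matrix.conjTranspose_apply, eval_star]

theorem map_eval_injective {m : ℕ} {x y : Matrix (Fin m) (Fin m) (FejerRiesz n)}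
    (h : ∀ ζ, x.map (eval ζ) = y.map (eval ζ)) : x = y := by
  ext1 i j
  rw [← sub_eq_zero]
  refine eq_zero_of_eval fun ζ => ?_
  rw [map_sub, sub_eq_zero]
  exact congrFun (congrFun (h ζ) i) j

theorem map_eval_one {m : ℕ} (hn : 0 < n) (ζ : Circle) :
    (Matrix.diagonal fun _ : Fin m => (1 : FejerRiesz n)).map (eval ζ) = 1 := by
  rw [Matrix.diagonal_map (map_zero _), eval_one hn]
  rfl

theorem eq_zero_of_not_pos (hn : ¬ 0 < n) (a : FejerRiesz n) : a = 0 := by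
  refine Subtype.ext (funext fun k => apply_eq_zero a ?_)
  simp only [Set.mem_Ioo]
  omega

end FejerRiesz

/-- The Fejér–Riesz operator system in `C^*(ℤ) ≅ C(S^1)`: since `M_m(C(S^1)) = C(S^1, M_m(ℂ))`,
a matrix `x` over `C^*(ℤ)_{(-n,n)}` is positive if for all `ζ ∈ S^1` the complex matrix
`(∑_k (x_{ij})_k ζ^k)_{ij}` is positive semidefinite; the order unit is `δ_0`. -/
def fejerRieszSystem (n : ℕ) : OperatorSystem (FejerRiesz n) where
  cone m := {x | ∀ ζ : Circle, (x.map (FejerRiesz.eval ζ)).PosSemidef}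
  zero_mem m ζ := by
    rw [Matrix.map_zero _ (map_zero _)]
    exact Matrix.PosSemidef.zero
  add_mem hx hy ζ := by
    rw [FejerRiesz.map_eval_add]
    exact (hx ζ).add (hy ζ)
  smul_mem hr hx ζ := by
    rw [FejerRiesz.map_eval_smul]
    exact (hx ζ).smul (by exact_mod_cast hr)
  hermitian hx := FejerRiesz.map_eval_injective fun ζ => by
    rw [FejerRiesz.map_eval_conjTranspose]
    exact (hx ζ).1
  proper {m x} hx hx' := FejerRiesz.map_eval_injective fun ζ => by
    have := hx' ζ
    rw [FejerRiesz.map_eval_neg] at this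
    rw [posSemidef_eq_zero (hx ζ) this, Matrix.map_zero _ (map_zero _)]
  conj_mem {_ _} A {_} hx ζ := by
    rw [FejerRiesz.map_eval_scalarConj]
    exact (hx ζ).mul_mul_conjTranspose_same _
  unit := 1
  star_unit := Subtype.ext (by
    ext k
    simp only [FejerRiesz.star_apply, FejerRiesz.one_apply, neg_eq_zero]
    split_ifs <;> simp)
  order_unit {m x} hx := by
    by_cases hn : 0 < n
    · have hH : ∀ ζ, (x.map (FejerRiesz.eval ζ)).IsHermitian := fun ζ => by
        rw [Matrix.IsHermitian, ← FejerRiesz.map_eval_conjTranspose, hx]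
      set C : ℝ := ∑ i, ∑ j, ∑ k ∈ Finset.Ioo (-(n : ℤ)) n, ‖x i j k‖ with hCdef
      have hC0 : 0 ≤ C := by positivity
      have hC : ∀ ζ i j, ‖x.map (FejerRiesz.eval ζ) i j‖ ≤ C := fun ζ i j =>
        (FejerRiesz.norm_eval_le ζ (x i j)).trans <|
        (Finset.single_le_sum (f := fun j => ∑ k ∈ Finset.Ioo (-(n : ℤ)) n, ‖x i j k‖)
          (fun _ _ => Finset.sum_nonneg fun _ _ => norm_nonneg _) (Finset.mem_univ j)).trans
        (Finset.single_le_sum (f := fun i => ∑ j, ∑ k ∈ Finset.Ioo (-(n : ℤ)) n, ‖x i j k‖)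
          (fun _ _ => Finset.sum_nonneg fun _ _ => Finset.sum_nonneg fun _ _ => norm_nonneg _)
          (Finset.mem_univ i))
      refine ⟨C * Fintype.card (Fin m) + 1, by positivity, fun ζ => ?_, fun ζ => ?_⟩
      · rw [sub_eq_add_neg, FejerRiesz.map_eval_add, FejerRiesz.map_eval_smul,
          FejerRiesz.map_eval_one hn, FejerRiesz.map_eval_neg]
        exact posSemidef_add_of_bound (hH ζ).neg hC0
          (fun i j => by rw [Matrix.neg_apply, norm_neg]; exact hC ζ i j) (by simp)
      · rw [FejerRiesz.map_eval_add, FejerRiesz.map_eval_smul, FejerRiesz.map_eval_one hn]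
        exact posSemidef_add_of_bound (hH ζ) hC0 (hC ζ) (by simp)
    · have h0 : ∀ y : Matrix (Fin m) (Fin m) (FejerRiesz n), y = 0 := fun y => by
        ext1 i j
        exact FejerRiesz.eq_zero_of_not_pos hn _
      have h1 : ∀ (y : Matrix (Fin m) (Fin m) (FejerRiesz n)) (ζ : Circle),
          (y.map (FejerRiesz.eval ζ)).PosSemidef := fun y ζ => by
        rw [h0 y, Matrix.map_zero _ (map_zero _)]
        exact Matrix.PosSemidef.zero
      exact ⟨1, one_pos, h1 _, h1 _⟩
  archimedean {m x} h ζ := by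
    by_cases hn : 0 < n
    · refine posSemidef_of_forall_add fun t ht => ?_
      have := h t ht ζ
      rwa [FejerRiesz.map_eval_add, FejerRiesz.map_eval_smul,
        FejerRiesz.map_eval_one hn] at this
    · have h0 : x = 0 := by
        ext1 i j
        exact FejerRiesz.eq_zero_of_not_pos hn _
      rw [h0, Matrix.map_zero _ (map_zero _)]
      exact Matrix.PosSemidef.zero

/-! ### Linear isometries of finite-dimensional complex inner product spaces -/

section Isometry

variable {H : Type*} [NormedAddCommGroup H] [InnerProductSpace ℂ H]

/-! The positive block Toeplitz matrices are exactly the sums of the elementary ones `(star (c i) *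
c j * ζ ^ (l - k))` with `ζ` on the circle, and pairing an elementary one with `a` gives `c^* a(ζ)
c`. So a positive `T` pairs nonnegatively with every positive `a`.

The decomposition (`Matrix.PosSemidef.exists_toeplitz_decomposition`) is spectral. Write the matrix
as the Gram matrix of vectors `ξ (i, k)`. Constancy along diagonals says that the shift `ξ (i, k) ↦
ξ (i, k + 1)` preserves inner products, so it extends to an isometry `U` of a finite-dimensional
space. An orthonormal eigenbasis of `U` turns powers of the shift into powers of eigenvalues `ζ s`
of modulus one.

Conversely, a vector `w` defines a positive element `a` whose value at each `ζ` has rank at most one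
and whose pairing with `T` is `w^* T w`; hence functionals in the dual cone come from positive
matrices (`Toep.posSemidef_of_map_dualEquiv_mem_dual`). No factorization of positive trigonometric
polynomials is needed.

The order unit axioms of the dual are then carried over from the Toeplitz system. Faithfulness
follows because an order unit dominates every hermitian functional: where it vanishes on a positive
`a`, all functionals vanish, in particular the evaluations at points of the circle. -/

theorem norm_linearCombination_eq_of_inner_eq {ι : Type*} [Fintype ι] {a b : ι → H}
    (h : ∀ i j, inner ℂ (a i) (a j) = inner ℂ (b i) (b j)) (c : ι → ℂ) :
    ‖Fintype.linearCombination ℂ a c‖ = ‖Fintype.linearCombination ℂ b c‖ := by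
  rw [@norm_eq_sqrt_re_inner ℂ, @norm_eq_sqrt_re_inner ℂ]
  simp only [Fintype.linearCombination_apply, sum_inner, inner_sum, inner_smul_left,
    inner_smul_right, h]

/-- Two finite families with the same Gram matrix are related by a linear isometry. -/
theorem exists_linearIsometry_of_inner_eq [FiniteDimensional ℂ H] {ι : Type*} [Fintype ι]
    {a b : ι → H} (h : ∀ i j, inner ℂ (a i) (a j) = inner ℂ (b i) (b j)) :
    ∃ U : H →ₗᵢ[ℂ] H, ∀ i, U (a i) = b i := by
  classical
  set A := Fintype.linearCombination ℂ a
  set B := Fintype.linearCombination ℂ b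
  have hAB : ∀ c, ‖A c‖ = ‖B c‖ := norm_linearCombination_eq_of_inner_eq h
  -- Equal norms force every linear relation among the `a i` to hold among the `b i`, so `A c ↦ B c`
  -- is well defined on the range of `A`.
  have hker : LinearMap.ker A ≤ LinearMap.ker B := fun c hc => by
    rw [LinearMap.mem_ker, ← norm_eq_zero] at hc ⊢
    rw [← hAB, hc]
  let L : LinearMap.range A →ₗ[ℂ] H :=
    (LinearMap.ker A).liftQ B hker ∘ₗ A.quotKerEquivRange.symm.toLinearMap
  have hL : ∀ c, L ⟨A c, LinearMap.mem_range_self A c⟩ = B c := fun c => by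
    have : A.quotKerEquivRange.symm ⟨A c, LinearMap.mem_range_self A c⟩ =
        Submodule.Quotient.mk c := by
      rw [LinearEquiv.symm_apply_eq]
      rfl
    simp only [L, LinearMap.comp_apply, LinearEquiv.coe_coe, this]
    rfl
  let V : LinearMap.range A →ₗᵢ[ℂ] H := ⟨L, by
    rintro ⟨_, c, rfl⟩
    rw [hL c, ← hAB]
    rfl⟩
  -- Domain and image have equal finite dimension, hence so do their orthogonal complements, and the
  -- partial isometry extends to all of `H`.
  refine ⟨V.extend, fun i => ?_⟩
  have hA : A (Pi.single i 1) = a i := by simp [A]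
  have hB : B (Pi.single i 1) = b i := by simp [B]
  have := V.extend_apply ⟨A (Pi.single i 1), LinearMap.mem_range_self A _⟩
  rw [← hA, ← hB, ← hL]
  exact this

/-! ### Spectral theorem for isometries -/

open Module.End

theorem LinearIsometry.norm_of_mem_eigenspace (U : H →ₗᵢ[ℂ] H) {μ : ℂ} {v : H}
    (hv : v ∈ eigenspace U.toLinearMap μ) (hv0 : v ≠ 0) : ‖μ‖ = 1 := by
  have h := U.norm_map v
  rw [mem_eigenspace_iff] at hv
  change U v = μ • v at hv
  rw [hv, norm_smul] at h
  exact mul_right_cancel₀ (norm_ne_zero_iff.mpr hv0) (h.trans (one_mul _).symm)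

/-- From `⟪U v, U w⟫ = ⟪v, w⟫` and `U v = μ • v` with `|μ| = 1`: an eigenvector of `U` is also one
of the adjoint. This plays the role of normality in the diagonalization. -/
theorem LinearIsometry.inner_eigenvector_map (U : H →ₗᵢ[ℂ] H) {μ : ℂ} {v : H}
    (hv : v ∈ eigenspace U.toLinearMap μ) (w : H) :
    inner ℂ v (U w) = μ * inner ℂ v w := by
  by_cases hv0 : v = 0
  · simp [hv0]
  have h := U.inner_map_map v w
  have hμ := U.norm_of_mem_eigenspace hv hv0
  rw [mem_eigenspace_iff] at hv
  change U v = μ • v at hv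
  rw [hv, inner_smul_left] at h
  rw [← h, ← mul_assoc, Complex.mul_conj, Complex.normSq_eq_norm_sq, hμ]
  simp

theorem LinearIsometry.orthogonalFamily_eigenspaces (U : H →ₗᵢ[ℂ] H) :
    OrthogonalFamily ℂ (fun μ : Eigenvalues U.toLinearMap => eigenspace U.toLinearMap μ)
      fun μ => (eigenspace U.toLinearMap μ).subtypeₗᵢ := by
  rintro μ ν hμν ⟨v, hv⟩ ⟨w, hw⟩
  have h := U.inner_eigenvector_map hv w
  rw [mem_eigenspace_iff] at hw
  change U w = (ν : ℂ) • w at hw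
  rw [hw, inner_smul_right] at h
  by_contra h0
  exact hμν (Subtype.ext (mul_right_cancel₀ h0 h)).symm

theorem LinearIsometry.map_mem_orthogonal_iSup_eigenspace (U : H →ₗᵢ[ℂ] H) {v : H}
    (hv : v ∈ (⨆ μ, eigenspace U.toLinearMap μ)ᗮ) :
    U v ∈ (⨆ μ, eigenspace U.toLinearMap μ)ᗮ := by
  rw [← Submodule.iInf_orthogonal, Submodule.mem_iInf] at hv ⊢
  intro μ w hw
  rw [U.inner_eigenvector_map hw, hv μ w hw, mul_zero]

variable [FiniteDimensional ℂ H]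

/-- The complement is `U`-invariant, so if nonzero it would contain an eigenvector over `ℂ`, which
would be orthogonal to its own eigenspace. -/
theorem LinearIsometry.orthogonal_iSup_eigenspace_eq_bot (U : H →ₗᵢ[ℂ] H) :
    (⨆ μ, eigenspace U.toLinearMap μ)ᗮ = ⊥ := by
  set p := (⨆ μ, eigenspace U.toLinearMap μ)ᗮ with hp
  by_contra hne
  have : Nontrivial p := Submodule.nontrivial_iff_ne_bot.mpr hne
  have hinv : ∀ v ∈ p, U.toLinearMap v ∈ p := fun v hv =>
    U.map_mem_orthogonal_iSup_eigenspace hv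
  obtain ⟨μ, hμ⟩ := exists_eigenvalue (U.toLinearMap.restrict hinv)
  refine hμ (eigenspace_restrict_eq_bot hinv ?_)
  have H₂ : eigenspace U.toLinearMap μ ⟂ p :=
    (Submodule.isOrtho_orthogonal_right _).mono_left (le_iSup _ _)
  exact H₂.disjoint

theorem LinearIsometry.isInternal_eigenspaces [DecidableEq ℂ] (U : H →ₗᵢ[ℂ] H) :
    DirectSum.IsInternal
      fun μ : Eigenvalues U.toLinearMap => eigenspace U.toLinearMap μ := by
  rw [U.orthogonalFamily_eigenspaces.isInternal_iff]
  change (⨆ μ : { μ // eigenspace U.toLinearMap μ ≠ ⊥ }, eigenspace U.toLinearMap μ)ᗮ = ⊥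
  rw [iSup_ne_bot_subtype, U.orthogonal_iSup_eigenspace_eq_bot]

/-- A linear isometry of a finite-dimensional complex inner product space is unitarily
diagonalizable, with eigenvalues on the unit circle. -/
theorem LinearIsometry.exists_orthonormalBasis_eigenvectors (U : H →ₗᵢ[ℂ] H) :
    ∃ (e : OrthonormalBasis (Fin (Module.finrank ℂ H)) ℂ H)
      (ζ : Fin (Module.finrank ℂ H) → Circle),
      ∀ s w, inner ℂ (e s) (U w) = ζ s * inner ℂ (e s) w := by
  classical
  let e := U.isInternal_eigenspaces.subordinateOrthonormalBasis rfl
    U.orthogonalFamily_eigenspaces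
  have he : ∀ s, ∃ μ : ℂ, e s ∈ eigenspace U.toLinearMap μ := fun s =>
    ⟨_, U.isInternal_eigenspaces.subordinateOrthonormalBasis_subordinate rfl s
      U.orthogonalFamily_eigenspaces⟩
  choose μ hμ using he
  have hn : ∀ s, ‖μ s‖ = 1 := fun s => U.norm_of_mem_eigenspace (hμ s) (e.orthonormal.ne_zero s)
  exact ⟨e, fun s => ⟨μ s, mem_sphere_zero_iff_norm.mpr (hn s)⟩,
    fun s w => U.inner_eigenvector_map (hμ s) w⟩

end Isometry

/-- **Carathéodory–Toeplitz decomposition**: a positive semidefinite block Toeplitz matrix is a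
finite sum of rank-one Toeplitz matrices with frequencies on the unit circle. -/
theorem Matrix.PosSemidef.exists_toeplitz_decomposition {ι : Type*} [Fintype ι] {n : ℕ}
    {M : Matrix (ι × Fin n) (ι × Fin n) ℂ} (hM : M.PosSemidef) (t : ι → ι → ℤ → ℂ)
    (ht : ∀ i j (k l : Fin n), M (i, k) (j, l) = t i j ((k : ℤ) - l)) :
    ∃ (d : ℕ) (ζ : Fin d → Circle) (c : Fin d → ι → ℂ), ∀ i j (k l : Fin n),
      M (i, k) (j, l) = ∑ s, star (c s i) * c s j * (ζ s : ℂ) ^ ((l : ℤ) - k) := by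
  classical
  obtain ⟨d, v, hv⟩ := Matrix.posSemidef_iff_eq_sum_vecMulVec.mp hM
  -- The conjugate is needed because the inner product is conjugate-linear in its first argument.
  let ξ : ι × Fin n → EuclideanSpace ℂ (Fin d) := fun p => WithLp.toLp 2 fun r => star (v r p)
  have hξ : ∀ p q, M p q = inner ℂ (ξ p) (ξ q) := fun p q => by
    rw [hv, Matrix.sum_apply]
    simp [ξ, Matrix.vecMulVec_apply, PiLp.inner_apply, mul_comm]
  rcases n with _ | n
  · exact ⟨0, Fin.elim0, Fin.elim0, fun _ _ k => k.elim0⟩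
  -- Raising both `k` and `l` by one leaves `k - l` unchanged, so the two shifted families have the
  -- same Gram matrix.
  obtain ⟨U, hU⟩ := exists_linearIsometry_of_inner_eq
    (a := fun p : ι × Fin n => ξ (p.1, p.2.castSucc))
    (b := fun p : ι × Fin n => ξ (p.1, p.2.succ)) (fun p q => by
      rw [← hξ, ← hξ, ht, ht]
      congr 1
      simp)
  obtain ⟨e, ζ, hζ⟩ := U.exists_orthonormalBasis_eigenvectors
  have hpow : ∀ s i (k : Fin (n + 1)),
      inner ℂ (e s) (ξ (i, k)) = (ζ s : ℂ) ^ (k : ℕ) * inner ℂ (e s) (ξ (i, 0)) := by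
    intro s i k
    induction k using Fin.induction with
    | zero => simp
    | succ k ih =>
      rw [← hU (i, k), hζ, ih, Fin.val_succ, pow_succ', mul_assoc, Fin.val_castSucc]
  -- Parseval in the basis `e`: the first factor contributes `conj (ζ s ^ k) = ζ s ^ (-k)`, the
  -- second `ζ s ^ l`.
  refine ⟨_, ζ, fun s i => inner ℂ (e s) (ξ (i, 0)), fun i j k l => ?_⟩
  rw [hξ, ← e.sum_inner_mul_inner]
  refine Finset.sum_congr rfl fun s _ => ?_
  rw [← inner_conj_symm, hpow s i k, hpow s j l, zpow_sub₀ (Circle.coe_ne_zero _), map_mul, map_pow,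
    ← Circle.coe_inv_eq_conj, Circle.coe_inv, zpow_natCast, zpow_natCast, inv_pow,
    starRingEnd_apply]
  field_simp

/-! ### The pairing of Toeplitz matrices with the Fejér–Riesz system -/

namespace Toep

variable {n : ℕ}

/-- The coefficient `t_k` of a Toeplitz matrix `(t_{k-l})_{k,l}`, and `0` for `|k| ≥ n`. -/
def coeff (T : Toep n) (k : ℤ) : ℂ :=
  if h : k.toNat < n ∧ (-k).toNat < n then
    (T : Matrix (Fin n) (Fin n) ℂ) ⟨k.toNat, h.1⟩ ⟨(-k).toNat, h.2⟩ else 0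

theorem coeff_add (S T : Toep n) (k : ℤ) : coeff (S + T) k = coeff S k + coeff T k := by
  unfold coeff
  split_ifs <;> simp

theorem coeff_smul (c : ℂ) (T : Toep n) (k : ℤ) : coeff (c • T) k = c * coeff T k := by
  unfold coeff
  split_ifs <;> simp

/-- Since `k` is its positive part minus its negative part, the entry chosen in `coeff`, in the
first row or column, lies on the `k`-th diagonal. Hence the coefficients with `|k| < n` do not
depend on the representing sequence. -/
theorem coeff_eq {T : Toep n} {t : ℤ → ℂ}
    (h : ∀ k l : Fin n, (T : Matrix (Fin n) (Fin n) ℂ) k l = t ((k : ℤ) - (l : ℤ))) {k : ℤ}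
    (hk : k ∈ Finset.Ioo (-(n : ℤ)) n) : coeff T k = t k := by
  rw [Finset.mem_Ioo] at hk
  rw [coeff, dif_pos (by omega), h]
  congr 1
  dsimp only
  omega

theorem apply_eq_coeff (T : Toep n) (k l : Fin n) :
    (T : Matrix (Fin n) (Fin n) ℂ) k l = coeff T ((k : ℤ) - l) := by
  obtain ⟨t, ht⟩ := T.2
  rw [coeff_eq ht (by rw [Finset.mem_Ioo]; omega), ht]

/-- The functional `φ_T(a) = ∑_k a_k t_{-k}`. -/
noncomputable def functional : Toep n →ₗ[ℂ] DualSpace (FejerRiesz n) where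
  toFun T :=
    ({ toFun := fun a => ∑ k ∈ Finset.Ioo (-(n : ℤ)) n, a k * coeff T (-k)
       map_add' := fun a b => by simp [add_mul, Finset.sum_add_distrib]
       map_smul' := fun c a => by simp [Finset.mul_sum, mul_assoc] } : FejerRiesz n →ₗ[ℂ] ℂ)
  map_add' S T := by
    ext a
    change ∑ k ∈ Finset.Ioo (-(n : ℤ)) n, a k * coeff (S + T) (-k) =
      ∑ k ∈ Finset.Ioo (-(n : ℤ)) n, a k * coeff S (-k) +
        ∑ k ∈ Finset.Ioo (-(n : ℤ)) n, a k * coeff T (-k)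
    simp [coeff_add, mul_add, Finset.sum_add_distrib]
  map_smul' c T := by
    ext a
    change ∑ k ∈ Finset.Ioo (-(n : ℤ)) n, a k * coeff (c • T) (-k) =
      c * ∑ k ∈ Finset.Ioo (-(n : ℤ)) n, a k * coeff T (-k)
    simp [coeff_smul, Finset.mul_sum, mul_left_comm]

theorem functional_apply (T : Toep n) (a : FejerRiesz n) :
    functional T a = ∑ k ∈ Finset.Ioo (-(n : ℤ)) n, a k * coeff T (-k) := rfl

theorem functional_apply_eq {T : Toep n} {t : ℤ → ℂ}
    (h : ∀ k l : Fin n, (T : Matrix (Fin n) (Fin n) ℂ) k l = t ((k : ℤ) - (l : ℤ)))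
    (a : FejerRiesz n) :
    functional T a = ∑ k ∈ Finset.Ioo (-(n : ℤ)) n, a k * t (-k) := by
  rw [functional_apply]
  refine Finset.sum_congr rfl fun k hk => ?_
  rw [coeff_eq h]
  rw [Finset.mem_Ioo] at hk ⊢
  omega

end Toep

/-! ### The basis of the Fejér–Riesz system -/

namespace FejerRiesz

variable {n : ℕ}

/-- The sequence `δ_k`, and `0` for `|k| ≥ n`. -/
noncomputable def delta (k : ℤ) : FejerRiesz n :=
  ⟨fun l => if l = k ∧ k ∈ Set.Ioo (-(n : ℤ)) n then 1 else 0, fun l hl => by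
    by_cases h : l = k ∧ k ∈ Set.Ioo (-(n : ℤ)) n
    · exact h.1 ▸ h.2
    · exact absurd (if_neg h) hl⟩

theorem delta_apply {k : ℤ} (hk : k ∈ Finset.Ioo (-(n : ℤ)) n) (l : ℤ) :
    (delta k : FejerRiesz n) l = if l = k then 1 else 0 := by
  have hk' : k ∈ Set.Ioo (-(n : ℤ)) n := by simpa using hk
  simp [delta, hk'.1, hk'.2]

theorem eval_delta {k : ℤ} (hk : k ∈ Finset.Ioo (-(n : ℤ)) n) (ζ : Circle) :
    eval ζ (delta k : FejerRiesz n) = (ζ : ℂ) ^ k := by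
  rw [eval_apply, Finset.sum_eq_single_of_mem k hk]
  · simp [delta_apply hk]
  · intro l _ hl
    simp [delta_apply hk, hl]

theorem eq_sum_delta (a : FejerRiesz n) :
    a = ∑ k ∈ Finset.Ioo (-(n : ℤ)) n, a k • delta k := by
  refine Subtype.ext (funext fun l => ?_)
  rw [Submodule.coe_sum, Finset.sum_apply]
  simp only [Submodule.coe_smul, Pi.smul_apply, smul_eq_mul]
  by_cases hl : l ∈ Finset.Ioo (-(n : ℤ)) n
  · rw [Finset.sum_eq_single_of_mem l hl]
    · simp [delta_apply hl]
    · intro k hk hkl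
      simp [delta_apply hk, hkl.symm]
  · rw [Finset.sum_eq_zero fun k hk => ?_]
    · exact apply_eq_zero a (by simpa using hl)
    · rw [delta_apply hk, if_neg (by rintro rfl; exact hl hk), mul_zero]

theorem sub_mem_Ioo (k l : Fin n) : (k : ℤ) - l ∈ Finset.Ioo (-(n : ℤ)) n := by
  rw [Finset.mem_Ioo]
  omega

end FejerRiesz

/-! ### Toeplitz matrices as the dual of the Fejér–Riesz system -/

namespace Toep

variable {n : ℕ}

theorem functional_delta (T : Toep n) {k : ℤ} (hk : k ∈ Finset.Ioo (-(n : ℤ)) n) :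
    functional T (FejerRiesz.delta k) = coeff T (-k) := by
  rw [functional_apply, Finset.sum_eq_single_of_mem k hk]
  · simp [FejerRiesz.delta_apply hk]
  · intro l _ hl
    simp [FejerRiesz.delta_apply hk, hl]

theorem functional_delta_sub (T : Toep n) (k l : Fin n) :
    functional T (FejerRiesz.delta ((l : ℤ) - k)) = (T : Matrix (Fin n) (Fin n) ℂ) k l := by
  rw [functional_delta T (FejerRiesz.sub_mem_Ioo l k), neg_sub, ← apply_eq_coeff]

/-- The linear isomorphism `T ↦ φ_T` from Toeplitz matrices onto the dual of the Fejér–Riesz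
system. -/
noncomputable def dualEquiv (n : ℕ) : Toep n ≃ₗ[ℂ] DualSpace (FejerRiesz n) where
  __ := functional
  -- Forced by `φ_T(δ_k) = t_{-k}`: the entry `t_{k-l}` is the value at `δ_{l-k}`.
  invFun φ := ⟨Matrix.of fun k l => φ (FejerRiesz.delta ((l : ℤ) - k)),
    fun k => φ (FejerRiesz.delta (-k)), fun k l => by simp⟩
  left_inv T := by
    ext k l
    exact functional_delta_sub T k l
  right_inv φ := by
    ext a
    refine (functional_apply_eq (t := fun k => φ (FejerRiesz.delta (-k)))
      (fun k l => by simp) a).trans ?_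
    conv_rhs => rw [FejerRiesz.eq_sum_delta a]
    simp only [map_sum, map_smul, neg_neg, smul_eq_mul]

theorem dualEquiv_apply (T : Toep n) : dualEquiv n T = functional T := rfl

theorem dualEquiv_star (T : Toep n) : dualEquiv n (star T) = star (dualEquiv n T) := by
  have h : ∀ k l : Fin n, ((star T : Toep n) : Matrix (Fin n) (Fin n) ℂ) k l =
      (fun k => star (coeff T (-k))) ((k : ℤ) - l) := fun k l => by
    dsimp only
    rw [coe_star, Matrix.conjTranspose_apply, apply_eq_coeff, neg_sub]
  ext a
  rw [dualEquiv_apply, functional_apply_eq (t := fun k => star (coeff T (-k))) h, DualSpace.star_apply, dualEquiv_apply,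
    functional_apply, star_sum]
  refine Finset.sum_nbij' (fun k => -k) (fun k => -k) ?_ ?_ ?_ ?_ ?_
  · intro k hk
    simp only [Finset.mem_Ioo] at hk ⊢
    omega
  · intro k hk
    simp only [Finset.mem_Ioo] at hk ⊢
    omega
  · simp
  · simp
  · intro k _
    simp [FejerRiesz.star_apply]

theorem map_dualEquiv_conjTranspose {m : ℕ} (x : Matrix (Fin m) (Fin m) (Toep n)) :
    xᴴ.map (dualEquiv n) = (x.map (dualEquiv n))ᴴ := by
  ext1 i j
  simp only [Matrix.map_apply, Matrix.conjTranspose_apply, dualEquiv_star]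

/-- By the Carathéodory–Toeplitz decomposition the pairing is a finite sum of quadratic forms `c^*
a(ζ) c`, each nonnegative since `a(ζ)` is positive semidefinite. -/
theorem map_dualEquiv_mem_dual_of_posSemidef {m : ℕ} {x : Matrix (Fin m) (Fin m) (Toep n)}
    (hx : (block x).PosSemidef) : x.map (dualEquiv n) ∈ (fejerRieszSystem n).dual.cone m := by
  intro a ha
  obtain ⟨d, ζ, c, hc⟩ := hx.exists_toeplitz_decomposition (fun i j => coeff (x i j))
    fun i j k l => apply_eq_coeff _ k l
  have hφ : ∀ i j, functional (x i j) (a i j) =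
      ∑ s, star (c s i) * (FejerRiesz.eval (ζ s) (a i j) * c s j) := fun i j => by
    -- The entry carries `ζ ^ (l - k)`, so `t_k` carries `ζ ^ (-k)`; the sign in `∑ a_k t_{-k}`
    -- undoes this and yields the evaluation at `ζ` itself.
    rw [functional_apply_eq (t := fun k => ∑ s, star (c s i) * c s j * (ζ s : ℂ) ^ (-k))
      fun k l => by simpa only [neg_sub] using! hc i j k l]
    simp only [neg_neg, Finset.mul_sum]
    rw [Finset.sum_comm]
    refine Finset.sum_congr rfl fun s _ => ?_
    rw [FejerRiesz.eval_apply, Finset.sum_mul, Finset.mul_sum]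
    exact Finset.sum_congr rfl fun k _ => by ring
  have hpair : matrixPairing (x.map (dualEquiv n)) a =
      ∑ s, star (c s) ⬝ᵥ (a.map (FejerRiesz.eval (ζ s))).mulVec (c s) := by
    simp only [matrixPairing, Matrix.map_apply, dualEquiv_apply, hφ, dotProduct, Matrix.mulVec,
      Pi.star_apply, Finset.mul_sum]
    rw [Finset.sum_comm (s := Finset.univ (α := Fin d))]
    exact Finset.sum_congr rfl fun i _ => Finset.sum_comm
  rw [hpair]
  exact Finset.sum_nonneg fun s _ => (ha (ζ s)).dotProduct_mulVec_nonneg (c s)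

/-- Every quadratic form value `w^* (block x) w` is the pairing with a positive element built from
`w`. -/
theorem posSemidef_of_map_dualEquiv_mem_dual {m : ℕ} {x : Matrix (Fin m) (Fin m) (Toep n)}
    (hx : x.map (dualEquiv n) ∈ (fejerRieszSystem n).dual.cone m) : (block x).PosSemidef := by
  have hstar : xᴴ = x := by
    have h := (fejerRieszSystem n).dual.hermitian hx
    rw [← map_dualEquiv_conjTranspose] at h
    exact Matrix.map_injective (dualEquiv n).injective h
  refine Matrix.PosSemidef.of_dotProduct_mulVec_nonneg ?_ fun w => ?_
  · rw [Matrix.IsHermitian, ← block_conjTranspose, hstar]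
  -- At `ζ` its entries are `star (v i) * v j` with `v i = ∑ k, w (i, k) ζ ^ k`, while pairing
  -- replaces `δ_{l-k}` by the matrix entry at `(k, l)`.
  let a : Matrix (Fin m) (Fin m) (FejerRiesz n) := Matrix.of fun i j =>
    ∑ k, ∑ l, (star (w (i, k)) * w (j, l)) • FejerRiesz.delta ((l : ℤ) - k)
  have ha : a ∈ (fejerRieszSystem n).cone m := fun ζ => by
    let v : Fin m → ℂ := fun i => ∑ k : Fin n, w (i, k) * (ζ : ℂ) ^ (k : ℕ)
    have : a.map (FejerRiesz.eval ζ) = Matrix.vecMulVec (star v) v := by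
      ext i j
      simp only [a, v, Matrix.map_apply, Matrix.of_apply, map_sum, map_smul, smul_eq_mul,
        Matrix.vecMulVec_apply, Pi.star_apply, star_sum, Finset.sum_mul_sum,
        FejerRiesz.eval_delta (FejerRiesz.sub_mem_Ioo _ _)]
      refine Finset.sum_congr rfl fun k _ => Finset.sum_congr rfl fun l _ => ?_
      rw [zpow_sub₀ (Circle.coe_ne_zero _), star_mul', star_pow, ← starRingEnd_apply (ζ : ℂ),
        ← Circle.coe_inv_eq_conj, Circle.coe_inv, zpow_natCast, zpow_natCast, inv_pow]
      field_simp
    rw [this]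
    exact Matrix.posSemidef_vecMulVec_star_self v
  convert hx a ha using 1
  simp only [matrixPairing, a, Matrix.map_apply, Matrix.of_apply, dualEquiv_apply, map_sum,
    map_smul, functional_delta_sub, dotProduct, Matrix.mulVec, Finset.mul_sum,
    Fintype.sum_prod_type, block, Pi.star_apply, smul_eq_mul]
  refine Finset.sum_congr rfl fun i _ => ?_
  rw [Finset.sum_comm]
  refine Finset.sum_congr rfl fun j _ => Finset.sum_congr rfl fun k _ =>
    Finset.sum_congr rfl fun l _ => by ring

theorem map_dualEquiv_mem_dual_iff {m : ℕ} {x : Matrix (Fin m) (Fin m) (Toep n)} :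
    x.map (dualEquiv n) ∈ (fejerRieszSystem n).dual.cone m ↔ x ∈ (toeplitzSystem n).cone m :=
  ⟨posSemidef_of_map_dualEquiv_mem_dual, map_dualEquiv_mem_dual_of_posSemidef⟩

end Toep

/-! ### Transport of order units -/

section Transport

variable {E : Type u} [AddCommGroup E] [Module ℂ E] [StarAddMonoid E] [StarModule ℂ E]
  {F : Type v} [AddCommGroup F] [Module ℂ F] [StarAddMonoid F] [StarModule ℂ F]

/-- A matrix order which is isomorphic to that of an operator system is an operator system. -/
def OperatorSystem.ofEquiv (S : OperatorSystem E) (N : MatrixOrdered F) (f : E ≃ₗ[ℂ] F)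
    (hstar : ∀ x, f (star x) = star (f x))
    (hcone : ∀ {m} {x : Matrix (Fin m) (Fin m) E}, x.map f ∈ N.cone m ↔ x ∈ S.cone m) :
    OperatorSystem F :=
  have hsurj : ∀ {m} (y : Matrix (Fin m) (Fin m) F), (y.map f.symm).map f = y := fun y => by
    ext; simp
  have hunit : ∀ {m : ℕ} (t : ℝ), ((t : ℂ) • Matrix.diagonal fun _ : Fin m => S.unit).map f =
      (t : ℂ) • Matrix.diagonal fun _ : Fin m => f S.unit := fun t => by
    ext i j
    by_cases h : i = j <;> simp [h, -Complex.coe_smul]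
  -- The cones of `N` are kept unchanged, so only the axioms of the unit have to be transported.
  { N with
    unit := f S.unit
    star_unit := by rw [← hstar, S.star_unit]
    order_unit := fun {m y} hy => by
      have hx : (y.map f.symm)ᴴ = y.map f.symm := by
        apply Matrix.map_injective f.injective
        refine Eq.trans ?_ (hsurj y).symm
        conv_rhs => rw [← hy]
        ext i j
        simp [hstar]
      obtain ⟨t, ht, h1, h2⟩ := S.order_unit hx
      rw [← hcone, Matrix.map_sub _ (map_sub f), hunit, hsurj] at h1
      rw [← hcone, Matrix.map_add _ (map_add f), hunit, hsurj] at h2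
      exact ⟨t, ht, h1, h2⟩
    archimedean := fun {m y} h => by
      rw [← hsurj y, hcone]
      refine S.archimedean fun t ht => ?_
      rw [← hcone, Matrix.map_add _ (map_add f), hunit, hsurj]
      exact h t ht }

/-- An order unit of the dual matrix order is a faithful positive functional. -/
theorem OperatorSystem.eq_zero_of_dual_unit_apply_eq_zero (S : OperatorSystem E)
    (D : OperatorSystem (DualSpace E)) (hD : D.toMatrixOrdered = S.dual) {x : E}
    (hx : x ∈ S.positive) (h0 : D.unit x = 0) : ∀ φ : DualSpace E, φ x = 0 := by
  have hcone : ∀ y, y ∈ D.cone 1 → 0 ≤ matrixPairing y (Matrix.of fun _ _ => x) := fun y hy => by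
    rw [hD] at hy
    exact hy _ hx
  -- Both `t • unit + y` and `t • unit - y` are nonnegative at `x`, where the unit vanishes, so `y`
  -- has value `0` there. Hermitian and skew parts then settle a general `φ`.
  have hherm : ∀ y : Matrix (Fin 1) (Fin 1) (DualSpace E), yᴴ = y → y 0 0 x = 0 := fun y hy => by
    obtain ⟨t, -, h1, h2⟩ := D.order_unit hy
    have h1 := hcone _ h1
    have h2 := hcone _ h2
    simp [matrixPairing, h0, sub_eq_add_neg, -Complex.coe_smul] at h1 h2
    exact le_antisymm h1 h2
  intro φ
  obtain ⟨y, z, hy, hz, h, -⟩ := hermitian_decomp (Matrix.of fun _ _ => φ : Matrix (Fin 1) (Fin 1) _)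
  have := congrArg (fun y => y 0 0 x) h
  simpa [hherm y hy, hherm z hz] using this

end Transport

/-! ### The duality theorem -/

theorem mainTheorem4 (n : ℕ) :
    ∃ (D : OperatorSystem (DualSpace (FejerRiesz n))) (Φ : Toep n ≃ₗ[ℂ] DualSpace (FejerRiesz n)),
      D.toMatrixOrdered = (fejerRieszSystem n).dual ∧
      (∀ (T : Toep n) (t : ℤ → ℂ),
        (∀ k l : Fin n, (T : Matrix (Fin n) (Fin n) ℂ) k l = t ((k : ℤ) - (l : ℤ))) →
        ∀ a : FejerRiesz n, Φ T a = ∑ k ∈ Finset.Ioo (-(n : ℤ)) n, a k * t (-k)) ∧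
      IsCompleteOrderIso (toeplitzSystem n).toMatrixOrdered D.toMatrixOrdered Φ ∧
      Φ 1 = D.unit ∧
      (0 < n → (fejerRieszSystem n).IsFaithfulState (Φ 1).toLinear) := by
  let D := (toeplitzSystem n).ofEquiv (fejerRieszSystem n).dual (Toep.dualEquiv n)
    Toep.dualEquiv_star Toep.map_dualEquiv_mem_dual_iff
  have hone : Toep.dualEquiv n 1 = D.unit := rfl
  -- Positivity of the identity matrix, through the case `m = 1` of the isomorphism.
  have hnonneg : ∀ x ∈ (fejerRieszSystem n).positive, 0 ≤ D.unit x := fun x hx => by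
    have h := Toep.map_dualEquiv_mem_dual_of_posSemidef (n := n) (m := 1)
      (x := Matrix.diagonal fun _ => 1) (by rw [Toep.block_one]; exact Matrix.PosSemidef.one) _ hx
    simpa [matrixPairing, hone] using h
  refine ⟨D, Toep.dualEquiv n, rfl, fun T t h a => Toep.functional_apply_eq h a, ⟨?_, ?_⟩, hone,
    fun hn => ⟨hnonneg, ?_, ?_⟩⟩
  · exact fun m x hx => Toep.map_dualEquiv_mem_dual_iff.mpr hx
  · intro m y hy
    refine Toep.map_dualEquiv_mem_dual_iff.mp ?_
    have hy' : y ∈ (fejerRieszSystem n).dual.cone m := hy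
    convert hy' using 1
    ext1 i j
    exact (Toep.dualEquiv n).apply_symm_apply (y i j)
  -- The identity matrix has symbol `δ_0`, so only the coefficient at `0` survives; it equals `1`
  -- because `0 < n`.
  · refine (Toep.functional_apply_eq (t := fun k => if k = 0 then 1 else 0) (fun k l => ?_)
      1).trans ?_
    · simp [Matrix.one_apply, sub_eq_zero, Fin.ext_iff]
    · rw [Finset.sum_eq_single_of_mem 0 (by simpa using hn)]
      · simp [FejerRiesz.one_apply, hn]
      · intro k _ hk
        simp [hk]
  · intro x hx hx0
    -- If the unit vanished at `x`, so would each evaluation at `ζ`, and these separate the points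
    -- of the space.
    refine (hnonneg x hx).lt_of_ne fun h => hx0 (FejerRiesz.eq_zero_of_eval fun ζ => ?_)
    exact (fejerRieszSystem n).eq_zero_of_dual_unit_apply_eq_zero D rfl hx h.symm
      (FejerRiesz.eval ζ)
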